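/- Let $\Gamma$ be a totally ordered abelian group (written additively) with positive cone $\Gamma^+=\{t\in\Gamma: t\ge 0\}$, and let $s\in\Gamma^+$. An order ideal of $\Gamma$ is a subgroup $J$ such that $x\in J$ and $0\le y\le x$ imply $y\in J$. For $t\in\Gamma^+$ let $K^s_t$ be the operator on $\ell^2([0,s))$, where $[0,s)=\{r\in\Gamma^+: r<s\}$, given on the usual orthonormal basis by $K^s_t\varepsilon_r=\varepsilon_{r+t}$ if $r+t\in[0,s)$ and $K^s_t\varepsilon_r=0$ otherwise, and let $C^*(K^s(\Gamma^+))$ be the $C^*$-algebra generated by $\{K^s_t:t\in\Gamma^+\}$. For a totally ordered abelian group $I$ with positive cone $I^+$, let $T_t$ ($t\in I^+$) be the isometry on $\ell^2(I^+)$ with $T_t\varepsilon_r=\varepsilon_{r+t}$, let $\mathcal T(I)$ be the $C^*$-algebra generated by $\{T_t:t\in I^+\}$, and let $\mathcal C_I$ be its commutator ideal, i.e. the smallest closed two-sided ideal of $\mathcal T(I)$ containing all commutators $ab-ba$ with $a,b\in\mathcal T(I)$. Then there is a smallest order ideal $I$ of $\Gamma$ containing $s$, and $$I^+ := I\cap\Gamma^+=\{t\in\Gamma^+: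 t\le ns\text{ for some }n\in\mathbb N\},$$ where $\mathbb N$ contains $0$. Moreover, with respect to $I$: the element $p:=1-T_sT_s^*$ is a projection belonging to $\mathcal C_I$; the $C^*$-algebra $C^*(K^s(\Gamma^+))$ is $*$-isomorphic to the corner $p\,\mathcal C_I\,p$; this corner is full, i.e. the closed linear span of $\mathcal C_I\,p\,\mathcal C_I$ is $\mathcal C_I$; and $C^*(K^s(\Gamma^+))$ is Morita equivalent to $\mathcal C_I$, i.e. there is a $C^*(K^s(\Gamma^+))$-$\mathcal C_I$-imprimitivity bimodule. -/

import Mathlib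

universe u v w

noncomputable section

/-! ### Order ideals and truncated shifts -/

/-- A subgroup `I` of an ordered group is an *order ideal* if `x ∈ I` and `0 ≤ y ≤ x` imply
`y ∈ I`. -/
def IsOrderIdeal {Γ : Type u} [AddCommGroup Γ] [LinearOrder Γ] (I : AddSubgroup Γ) : Prop :=
  ∀ x ∈ I, ∀ y : Γ, 0 ≤ y → y ≤ x → y ∈ I

/-- The Hilbert space `ℓ²(S)` of square-summable complex functions on a set `S`. -/
abbrev EllTwo {Γ : Type u} (S : Set Γ) : Type u := lp (fun _ : S => ℂ) 2

/-- The C⋆-algebra `B(ℓ²(S))` of bounded operators on `ℓ²(S)`. -/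
abbrev BEllTwo {Γ : Type u} (S : Set Γ) : Type u := EllTwo S →L[ℂ] EllTwo S

section Shift

variable {Γ : Type u} [AddCommGroup Γ] (S : Set Γ) (t : Γ)

open Classical in
/-- Translation by `t` of a function on `S`, extended by `0`: the value at `r` is `f (r - t)`
if `r - t ∈ S`, and `0` otherwise. -/
def shiftFun (f : S → ℂ) (r : S) : ℂ :=
  if h : (r : Γ) - t ∈ S then f ⟨(r : Γ) - t, h⟩ else 0

theorem norm_shiftFun_sq (f : S → ℂ) (r : S) :
    ‖shiftFun S t f r‖ ^ (2 : ENNReal).toReal =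
      Function.extend (Subtype.val : S → Γ) (fun q => ‖f q‖ ^ (2 : ENNReal).toReal) 0
        ((r : Γ) - t) := by
  by_cases h : (r : Γ) - t ∈ S
  · have := Subtype.val_injective.extend_apply
      (fun q : S => ‖f q‖ ^ (2 : ENNReal).toReal) 0 ⟨(r : Γ) - t, h⟩
    rw [show ((r : Γ) - t) = ((⟨(r : Γ) - t, h⟩ : S) : Γ) from rfl, this]
    simp [shiftFun, h]
  · rw [Function.extend_apply' _ _ _ (by rintro ⟨q, hq⟩; exact h (hq ▸ q.2))]
    simp [shiftFun, h]

theorem summable_extend_ellTwo (f : EllTwo S) :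
    Summable (Function.extend (Subtype.val : S → Γ)
      (fun q => ‖f q‖ ^ (2 : ENNReal).toReal) 0) :=
  (hasSum_extend_zero Subtype.val_injective).2
    ((lp.memℓp f).summable (by norm_num)).hasSum |>.summable

theorem sub_injective_subtype :
    Function.Injective (fun r : S => (r : Γ) - t) := fun _ _ h =>
  Subtype.ext (sub_left_injective h)

/-- The operator on `ℓ²(S)` with `ε_r ↦ ε_{r + t}` if `r + t ∈ S` and `ε_r ↦ 0` otherwise. -/
def truncShift : BEllTwo S :=
  LinearMap.mkContinuous
    { toFun := fun f => ⟨shiftFun S t f, memℓp_gen (by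
        simp_rw [norm_shiftFun_sq]
        exact (summable_extend_ellTwo S f).comp_injective (sub_injective_subtype S t))⟩
      map_add' := fun f g => by
        ext r
        change shiftFun S t (f + g : EllTwo S) r = shiftFun S t f r + shiftFun S t g r
        by_cases h : (r : Γ) - t ∈ S <;> simp [shiftFun, h]
      map_smul' := fun c f => by
        ext r
        change shiftFun S t (c • f : EllTwo S) r = c • shiftFun S t f r
        by_cases h : (r : Γ) - t ∈ S <;> simp [shiftFun, h] } 1 (fun f => by
    rw [one_mul]
    refine lp.norm_le_of_tsum_le (by norm_num) (norm_nonneg _) ?_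
    rw [lp.norm_rpow_eq_tsum (by norm_num) f,
      ← tsum_extend_zero Subtype.val_injective (fun q : S => ‖f q‖ ^ (2 : ENNReal).toReal)]
    refine le_trans (le_of_eq (tsum_congr fun r => norm_shiftFun_sq S t f r)) ?_
    refine tsum_comp_le_tsum_of_inj (summable_extend_ellTwo S f) (fun x => ?_)
      (sub_injective_subtype S t)
    by_cases h : ∃ q : S, (q : Γ) = x
    · obtain ⟨q, rfl⟩ := h
      rw [Subtype.val_injective.extend_apply]
      positivity
    · rw [Function.extend_apply' _ _ _ h]
      rfl)

open Classical in
theorem truncShift_apply (f : EllTwo S) (r : S) :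
    truncShift S t f r = if h : (r : Γ) - t ∈ S then f ⟨(r : Γ) - t, h⟩ else 0 := rfl

open Classical in
/-- The defining formula of the truncated shift on the orthonormal basis. -/
theorem truncShift_single (r : S) :
    truncShift S t (lp.single 2 r (1 : ℂ)) =
      if h : (r : Γ) + t ∈ S then lp.single 2 (⟨(r : Γ) + t, h⟩ : S) (1 : ℂ) else 0 := by
  ext q
  rw [truncShift_apply]
  by_cases h : (r : Γ) + t ∈ S
  · by_cases hq : (q : Γ) - t ∈ S
    · by_cases e : (q : Γ) = (r : Γ) + t
      · have e1 : q = ⟨(r : Γ) + t, h⟩ := Subtype.ext e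
        subst e1
        simp [h]
      · have e1 : q ≠ ⟨(r : Γ) + t, h⟩ := fun h' => e (congrArg Subtype.val h')
        have e2 : (⟨(q : Γ) - t, hq⟩ : S) ≠ r := fun h' => e (by
          rw [← h']; simp)
        simp [h, hq, e1, e2]
    · have e1 : q ≠ ⟨(r : Γ) + t, h⟩ := fun h' => hq (by rw [h']; simp)
      simp [h, hq, e1]
  · by_cases hq : (q : Γ) - t ∈ S
    · have e2 : (⟨(q : Γ) - t, hq⟩ : S) ≠ r := fun h' => h (by
        rw [← h']; simp)
      simp [h, hq, e2]
    · simp [h, hq]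

end Shift

/-! ### Generated C⋆-algebras, commutator ideals and corners -/

section CStar

variable {B : Type u} [NonUnitalCStarAlgebra B]

/-- The C⋆-subalgebra of `B` generated by `S`. -/
def cstarGenerated (S : Set B) : NonUnitalStarSubalgebra ℂ B :=
  (NonUnitalStarAlgebra.adjoin ℂ S).topologicalClosure

instance cstarGenerated_isClosed (S : Set B) : IsClosed (cstarGenerated S : Set B) :=
  NonUnitalStarSubalgebra.isClosed_topologicalClosure _

/-- `J` is a closed two-sided ideal of the subalgebra `A` of `B`. -/
structure IsClosedIdeal (A : NonUnitalStarSubalgebra ℂ B) (J : Submodule ℂ B) : Prop where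
  isClosed : IsClosed (J : Set B)
  le : ∀ x ∈ J, x ∈ A
  mul_mem_left : ∀ a ∈ A, ∀ x ∈ J, a * x ∈ J
  mul_mem_right : ∀ a ∈ A, ∀ x ∈ J, x * a ∈ J

/-- `J` is a closed two-sided ideal of `A` that contains all commutators of elements of `A`. -/
def IsCommutatorAbsorbing (A : NonUnitalStarSubalgebra ℂ B) (J : Submodule ℂ B) : Prop :=
  IsClosedIdeal A J ∧ ∀ a ∈ A, ∀ b ∈ A, a * b - b * a ∈ J

/-- The image of a complex subspace under the involution. -/
def starSubmodule (J : Submodule ℂ B) : Submodule ℂ B where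
  carrier := {x | star x ∈ J}
  add_mem' := fun {x y} hx hy => by
    simpa only [Set.mem_ofPred_eq, star_add] using J.add_mem hx hy
  zero_mem' := by simp
  smul_mem' := fun c x hx => by
    simpa only [Set.mem_ofPred_eq, star_smul] using J.smul_mem _ hx

theorem IsCommutatorAbsorbing.starSubmodule {A : NonUnitalStarSubalgebra ℂ B}
    {J : Submodule ℂ B} (h : IsCommutatorAbsorbing A J) :
    IsCommutatorAbsorbing A (starSubmodule J) := by
  refine ⟨⟨h.1.isClosed.preimage continuous_star, ?_, ?_, ?_⟩, ?_⟩
  · intro x hx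
    simpa using star_mem (h.1.le _ hx)
  · intro a ha x hx
    change star (a * x) ∈ J
    rw [star_mul]
    exact h.1.mul_mem_right _ (star_mem ha) _ hx
  · intro a ha x hx
    change star (x * a) ∈ J
    rw [star_mul]
    exact h.1.mul_mem_left _ (star_mem ha) _ hx
  · intro a ha b hb
    change star (a * b - b * a) ∈ J
    rw [star_sub, star_mul, star_mul]
    exact h.2 _ (star_mem hb) _ (star_mem ha)

theorem isCommutatorAbsorbing_closure (A : NonUnitalStarSubalgebra ℂ B)
    (hA : IsClosed (A : Set B)) : IsCommutatorAbsorbing A A.toSubmodule :=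
  ⟨⟨hA, fun _ hx => hx, fun _ ha _ hx => mul_mem (S := NonUnitalStarSubalgebra ℂ B) ha hx,
    fun _ ha _ hx => mul_mem (S := NonUnitalStarSubalgebra ℂ B) hx ha⟩,
    fun _ ha _ hb => sub_mem (S := NonUnitalStarSubalgebra ℂ B)
      (mul_mem (S := NonUnitalStarSubalgebra ℂ B) ha hb)
      (mul_mem (S := NonUnitalStarSubalgebra ℂ B) hb ha)⟩

/-- The *commutator ideal* of the C⋆-subalgebra `A` of `B`: the smallest closed two-sided ideal
of `A` that contains all commutators `a * b - b * a` with `a, b ∈ A`. -/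
def commutatorIdeal (A : NonUnitalStarSubalgebra ℂ B) [hA : IsClosed (A : Set B)] :
    NonUnitalStarSubalgebra ℂ B where
  carrier := {x | ∀ J : Submodule ℂ B, IsCommutatorAbsorbing A J → x ∈ J}
  add_mem' := fun hx hy J hJ => J.add_mem (hx J hJ) (hy J hJ)
  zero_mem' := fun J _ => J.zero_mem
  mul_mem' := fun {x y} hx hy J hJ =>
    hJ.1.mul_mem_left x (hx _ (isCommutatorAbsorbing_closure A hA)) y (hy J hJ)
  smul_mem' := fun c _ hx J hJ => J.smul_mem c (hx J hJ)
  star_mem' := fun {_} hx J hJ => hx _ hJ.starSubmodule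

theorem mem_commutatorIdeal {A : NonUnitalStarSubalgebra ℂ B} [IsClosed (A : Set B)] {x : B} :
    x ∈ commutatorIdeal A ↔ ∀ J : Submodule ℂ B, IsCommutatorAbsorbing A J → x ∈ J := Iff.rfl

instance commutatorIdeal_isClosed (A : NonUnitalStarSubalgebra ℂ B) [IsClosed (A : Set B)] :
    IsClosed (commutatorIdeal A : Set B) := by
  have : (commutatorIdeal A : Set B) =
      ⋂ (J : Submodule ℂ B) (_ : IsCommutatorAbsorbing A J), (J : Set B) := by
    ext x
    simp [mem_commutatorIdeal]
  rw [this]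
  exact isClosed_biInter fun J hJ => hJ.1.isClosed

/-- The corner `p C p = {p * c * p | c ∈ C}`, for a self-adjoint element `p` that multiplies `C`
into itself. -/
def cornerSubalgebra (C : NonUnitalStarSubalgebra ℂ B) (p : B) (hp : IsSelfAdjoint p)
    (hpC : ∀ c ∈ C, p * c ∈ C) : NonUnitalStarSubalgebra ℂ B where
  carrier := {x | ∃ c ∈ C, x = p * c * p}
  add_mem' := by
    rintro _ _ ⟨c, hc, rfl⟩ ⟨d, hd, rfl⟩
    exact ⟨c + d, add_mem hc hd, by rw [mul_add, add_mul]⟩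
  zero_mem' := ⟨0, zero_mem _, by simp⟩
  mul_mem' := by
    rintro _ _ ⟨c, hc, rfl⟩ ⟨d, hd, rfl⟩
    exact ⟨c * (p * (p * d)), mul_mem hc (hpC _ (hpC _ hd)), by simp only [mul_assoc]⟩
  smul_mem' := by
    rintro k _ ⟨c, hc, rfl⟩
    exact ⟨k • c, C.smul_mem k hc, by rw [mul_smul_comm, smul_mul_assoc]⟩
  star_mem' := by
    rintro _ ⟨c, hc, rfl⟩
    exact ⟨star c, star_mem hc, by simp [hp.star_eq, mul_assoc]⟩

/-- The corner `p C p` is *full* in `C`: the closed linear span of `C p C` is `C`. -/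
def IsFullCorner (C : NonUnitalStarSubalgebra ℂ B) (p : B) : Prop :=
  closure (Submodule.span ℂ {x : B | ∃ a ∈ C, ∃ b ∈ C, x = a * p * b} : Set B) = (C : Set B)

end CStar

/-! ### Morita equivalence -/

/-- An `A`-`B`-*imprimitivity bimodule* structure on a Banach space `X`: `X` is an
`A`-`B`-bimodule that is a full left Hilbert `A`-module and a full right Hilbert `B`-module, with
both actions adjointable for the inner product of the other side and
`⟪x, y⟫_A · z = x · ⟪y, z⟫_B`. The Hilbert module norms of the two sides, which always agree, are
the norm of `X`, so completeness of `X` is completeness of both Hilbert modules. -/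
structure ImprimitivityBimodule (A : Type u) (B : Type v) (X : Type w)
    [NonUnitalCStarAlgebra A] [NonUnitalCStarAlgebra B]
    [NormedAddCommGroup X] [NormedSpace ℂ X] [CompleteSpace X] where
  /-- the left action `a · x` -/
  lact : A →ₗ[ℂ] X →ₗ[ℂ] X
  /-- the right action `x · b` -/
  ract : X →ₗ[ℂ] B →ₗ[ℂ] X
  /-- the `A`-valued inner product, conjugate linear in the second variable -/
  linner : X →ₗ[ℂ] X →ₗ⋆[ℂ] A
  /-- the `B`-valued inner product, conjugate linear in the first variable -/
  rinner : X →ₗ⋆[ℂ] X →ₗ[ℂ] B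
  mul_lact : ∀ a a' x, lact (a * a') x = lact a (lact a' x)
  ract_mul : ∀ x b b', ract x (b * b') = ract (ract x b) b'
  lact_ract : ∀ a x b, ract (lact a x) b = lact a (ract x b)
  linner_lact : ∀ a x y, linner (lact a x) y = a * linner x y
  rinner_ract : ∀ x y b, rinner x (ract y b) = rinner x y * b
  star_linner : ∀ x y, star (linner x y) = linner y x
  star_rinner : ∀ x y, star (rinner x y) = rinner y x
  linner_self_nonneg : ∀ x, ∃ a, linner x x = star a * a
  rinner_self_nonneg : ∀ x, ∃ b, rinner x x = star b * b
  norm_linner_self : ∀ x, ‖linner x x‖ = ‖x‖ ^ 2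
  norm_rinner_self : ∀ x, ‖rinner x x‖ = ‖x‖ ^ 2
  linner_full : Dense (Submodule.span ℂ {a : A | ∃ x y, a = linner x y} : Set A)
  rinner_full : Dense (Submodule.span ℂ {b : B | ∃ x y, b = rinner x y} : Set B)
  rinner_lact : ∀ a x y, rinner (lact a x) y = rinner x (lact (star a) y)
  linner_ract : ∀ x y b, linner (ract x b) y = linner x (ract y (star b))
  linner_lact_eq_ract_rinner : ∀ x y z, lact (linner x y) z = ract x (rinner y z)

/-- Two C⋆-algebras are (strongly) *Morita equivalent* if there is an imprimitivity bimodule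
between them. -/
def MoritaEquivalent (A : Type u) (B : Type v)
    [NonUnitalCStarAlgebra A] [NonUnitalCStarAlgebra B] : Prop :=
  ∃ (X : Type (max u v)) (_ : NormedAddCommGroup X) (_ : NormedSpace ℂ X) (_ : CompleteSpace X),
    Nonempty (ImprimitivityBimodule A B X)

/-! ### Toeplitz algebras and algebras of truncated shifts -/

section Toeplitz

variable {Γ : Type u} [AddCommGroup Γ] [LinearOrder Γ]

/-- The partial isometry `K^s_t` on `ℓ²([0,s))`. -/
def shiftK (s t : Γ) : BEllTwo (Set.Ico 0 s) :=
  truncShift (Set.Ico 0 s) t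

/-- The C⋆-algebra `C⋆(K^s(Γ⁺))`. -/
def algebraK (s : Γ) :
    NonUnitalStarSubalgebra ℂ (BEllTwo (Set.Ico 0 s)) :=
  cstarGenerated {x | ∃ t : Γ, 0 ≤ t ∧ x = shiftK s t}

instance algebraK_isClosed (s : Γ) : IsClosed (algebraK s : Set (BEllTwo (Set.Ico 0 s))) :=
  cstarGenerated_isClosed _

/-- The isometry `T_s` on `ℓ²(Γ⁺)`, with `T_s ε_r = ε_{r + s}`, for `s ∈ Γ⁺`. -/
def shiftT (s : Γ) : BEllTwo (Set.Ici (0 : Γ)) :=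
  truncShift (Set.Ici 0) s

variable (Γ) in
/-- The Toeplitz algebra `𝒯(Γ)`, generated by the isometries `T_s` for `s ∈ Γ⁺`. -/
def toeplitzAlgebra :
    NonUnitalStarSubalgebra ℂ (BEllTwo (Set.Ici (0 : Γ))) :=
  cstarGenerated {x | ∃ s : Γ, 0 ≤ s ∧ x = shiftT s}

variable (Γ) in
instance toeplitzAlgebra_isClosed : IsClosed (toeplitzAlgebra Γ : Set (BEllTwo (Set.Ici (0 : Γ)))) :=
  cstarGenerated_isClosed _

variable (Γ) in
/-- The commutator ideal `𝒞_Γ` of the Toeplitz algebra `𝒯(Γ)`. -/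
def toeplitzCommutatorIdeal :
    NonUnitalStarSubalgebra ℂ (BEllTwo (Set.Ici (0 : Γ))) :=
  commutatorIdeal (toeplitzAlgebra Γ)

variable (Γ) in
instance toeplitzCommutatorIdeal_isClosed :
    IsClosed (toeplitzCommutatorIdeal Γ : Set (BEllTwo (Set.Ici (0 : Γ)))) :=
  commutatorIdeal_isClosed _

/-- The element `1 - T_s T_s⋆`. -/
def defectProj (s : Γ) : BEllTwo (Set.Ici (0 : Γ)) :=
  1 - shiftT s * star (shiftT s)

theorem isSelfAdjoint_defectProj (s : Γ) : IsSelfAdjoint (defectProj s) :=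
  (IsSelfAdjoint.one _).sub (IsSelfAdjoint.mul_star_self _)

theorem shiftT_mem_toeplitzAlgebra {s : Γ} (hs : 0 ≤ s) : shiftT s ∈ toeplitzAlgebra Γ :=
  NonUnitalStarSubalgebra.le_topologicalClosure _
    (NonUnitalStarAlgebra.subset_adjoin ℂ _ ⟨s, hs, rfl⟩)

theorem defectProj_mul_mem {s : Γ} (hs : 0 ≤ s) :
    ∀ c ∈ toeplitzCommutatorIdeal Γ, defectProj s * c ∈ toeplitzCommutatorIdeal Γ := by
  intro c hc J hJ
  rw [defectProj, sub_mul, one_mul]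
  exact J.sub_mem (hc J hJ) (hJ.1.mul_mem_left _ (mul_mem (shiftT_mem_toeplitzAlgebra hs)
    (star_mem (shiftT_mem_toeplitzAlgebra hs))) _ (hc J hJ))

/-- The corner `(1 - T_s T_s⋆) 𝒞_Γ (1 - T_s T_s⋆)` of the commutator ideal, for `s ∈ Γ⁺`. -/
def toeplitzCorner (s : Γ) (hs : 0 ≤ s) :
    NonUnitalStarSubalgebra ℂ (BEllTwo (Set.Ici (0 : Γ))) :=
  cornerSubalgebra (toeplitzCommutatorIdeal Γ) (defectProj s) (isSelfAdjoint_defectProj s)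
    (defectProj_mul_mem hs)

end Toeplitz

end

noncomputable section

/-! ### Generated C⋆-algebras and closed ideals -/

section CStarGenerated

variable {B : Type u} [NonUnitalCStarAlgebra B]

/-! Take `I` to be all `x` with `|x| ≤ n • s` for some `n`. As `I` is an order ideal containing `s`,
the interval `[0, s)` lies in `I⁺`. Let `W : ℓ²(I⁺) → ℓ²([0, s))` be restriction. Then `W W⋆ = 1`
and `W⋆ W = 1 - T_s T_s⋆ = p`, so `x ↦ W⋆ x W` is an isometric ⋆-isomorphism of `B(ℓ²([0, s)))` onto
the operators fixed by `p` on both sides, with inverse `y ↦ W y W⋆`.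

The isomorphism carries `C⋆(K^s(Γ⁺))` onto `p 𝒞_I p`. In one direction, `W⋆ K_t W = p T_t p` for `t
< s`, which is in the corner because `p = T_s⋆ T_s - T_s T_s⋆` is a commutator; for `t ≥ s`, `K_t =
0` (`icoExtend_mem_toeplitzCorner`). In the other, `𝒯(I)` is the closed span of the `T_a T_b⋆`, and
`p T_a = p T_a p` makes `W T_a T_b⋆ W⋆ = K_a K_b⋆` (`icoCompress_mem_algebraK`).

Fullness (`isFullCorner_defectProj`): the closed span `J` of `𝒞_I p 𝒞_I` is an ideal of `𝒯(I)`. It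
contains `p`, hence every `1 - T_{ns} T_{ns}⋆`, hence every `1 - T_t T_t⋆` since `t ≤ n • s`, hence
all commutators of generators. Minimality of `𝒞_I` gives `𝒞_I ⊆ J`. A full corner is Morita
equivalent to the whole algebra through the right ideal `p 𝒞_I` (`moritaEquivalent_of_fullCorner`).
-/

theorem subset_cstarGenerated (S : Set B) : S ⊆ cstarGenerated S := fun _ hx =>
  NonUnitalStarSubalgebra.le_topologicalClosure _ (NonUnitalStarAlgebra.subset_adjoin ℂ S hx)

/-- The star algebra generated by `S` is the plain algebra generated by `S ∪ star S`, so adjoints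
need checking only on generators; closedness of `P` then passes to the closure. -/
theorem cstarGenerated_induction {S : Set B} {P : B → Prop}
    (mem : ∀ x ∈ S, P x) (mem_star : ∀ x ∈ S, P (star x)) (zero : P 0)
    (add : ∀ x ∈ cstarGenerated S, ∀ y ∈ cstarGenerated S, P x → P y → P (x + y))
    (mul : ∀ x ∈ cstarGenerated S, ∀ y ∈ cstarGenerated S, P x → P y → P (x * y))
    (smul : ∀ (c : ℂ), ∀ x ∈ cstarGenerated S, P x → P (c • x))
    (closed : IsClosed {x | P x}) : ∀ x ∈ cstarGenerated S, P x := by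
  have hle : ∀ x ∈ NonUnitalAlgebra.adjoin ℂ (S ∪ star S), x ∈ cstarGenerated S := fun x hx =>
    NonUnitalStarSubalgebra.le_topologicalClosure (NonUnitalStarAlgebra.adjoin ℂ S) hx
  have key : ∀ x ∈ NonUnitalAlgebra.adjoin ℂ (S ∪ star S), P x := by
    intro x hx
    induction hx using NonUnitalAlgebra.adjoin_induction with
    | mem x hx =>
      rcases hx with hx | hx
      · exact mem x hx
      · simpa using mem_star _ hx
    | add x y hx hy h h' => exact add x (hle x hx) y (hle y hy) h h'
    | zero => exact zero
    | mul x y hx hy h h' => exact mul x (hle x hx) y (hle y hy) h h'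
    | smul c x hx h => exact smul c x (hle x hx) h
  intro x hx
  exact closure_minimal (s := (NonUnitalAlgebra.adjoin ℂ (S ∪ star S) : Set B)) key closed hx

/-- A closed ideal of `C⋆(S)` absorbs all commutators as soon as it contains those of the elements
of `S` and their adjoints. -/
theorem IsClosedIdeal.isCommutatorAbsorbing_of_generators {S : Set B} {J : Submodule ℂ B}
    (hJ : IsClosedIdeal (cstarGenerated S) J)
    (h : ∀ x ∈ S ∪ star S, ∀ y ∈ S ∪ star S, x * y - y * x ∈ J) :
    IsCommutatorAbsorbing (cstarGenerated S) J := by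
  have hmem : ∀ x ∈ S ∪ star S, x ∈ cstarGenerated S := by
    rintro x (hx | hx)
    · exact subset_cstarGenerated S hx
    · simpa using star_mem (subset_cstarGenerated S hx)
  -- For fixed `x` the commutator is a derivation in `y`, so the Leibniz rule extends membership in
  -- `J` from generators to the algebra. This is used once in each variable.
  have step : ∀ x ∈ cstarGenerated S, (∀ y ∈ S ∪ star S, x * y - y * x ∈ J) →
      ∀ y ∈ cstarGenerated S, x * y - y * x ∈ J := by
    intro x hx hg
    refine cstarGenerated_induction (fun y hy => hg y (Or.inl hy))
      (fun y hy => hg _ (Or.inr (by simpa using hy))) (by simp) ?_ ?_ ?_ ?_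
    · intro y _ z _ h1 h2
      have : x * (y + z) - (y + z) * x = (x * y - y * x) + (x * z - z * x) := by
        rw [mul_add, add_mul]; abel
      rw [this]
      exact J.add_mem h1 h2
    · intro y hy z hz h1 h2
      have : x * (y * z) - y * z * x = (x * y - y * x) * z + y * (x * z - z * x) := by
        simp only [sub_mul, mul_sub, mul_assoc]; abel
      rw [this]
      exact J.add_mem (hJ.mul_mem_right z hz _ h1) (hJ.mul_mem_left y hy _ h2)
    · intro c y _ h1
      rw [mul_smul_comm, smul_mul_assoc, ← smul_sub]
      exact J.smul_mem c h1
    · exact hJ.isClosed.preimage (f := fun y => x * y - y * x) (by fun_prop)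
  have swap : ∀ x y : B, x * y - y * x ∈ J → y * x - x * y ∈ J := fun x y hxy => by
    simpa using J.neg_mem hxy
  exact ⟨hJ, fun x hx => step x hx fun y hy => swap _ _
    (step y (hmem y hy) (fun z hz => h y hy z hz) x hx)⟩

theorem commutator_mem_commutatorIdeal {A : NonUnitalStarSubalgebra ℂ B} [IsClosed (A : Set B)]
    {a b : B} (ha : a ∈ A) (hb : b ∈ A) : a * b - b * a ∈ commutatorIdeal A :=
  fun _ hJ => hJ.2 a ha b hb

theorem commutatorIdeal_le (A : NonUnitalStarSubalgebra ℂ B) [hA : IsClosed (A : Set B)] :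
    commutatorIdeal A ≤ A :=
  fun _ hx => hx _ (isCommutatorAbsorbing_closure A hA)

theorem mul_mem_commutatorIdeal_left {A : NonUnitalStarSubalgebra ℂ B} [IsClosed (A : Set B)]
    {a x : B} (ha : a ∈ A) (hx : x ∈ commutatorIdeal A) : a * x ∈ commutatorIdeal A :=
  fun J hJ => hJ.1.mul_mem_left a ha x (hx J hJ)

theorem mul_mem_commutatorIdeal_right {A : NonUnitalStarSubalgebra ℂ B} [IsClosed (A : Set B)]
    {a x : B} (ha : a ∈ A) (hx : x ∈ commutatorIdeal A) : x * a ∈ commutatorIdeal A :=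
  fun J hJ => hJ.1.mul_mem_right a ha x (hx J hJ)

/-- If `C` absorbs multiplication by `A`, then the closed linear span of `C p C` is a closed ideal
of `A`. -/
theorem isClosedIdeal_closure_span_mul {A C : NonUnitalStarSubalgebra ℂ B}
    (hA : IsClosed (A : Set B)) (hCA : C ≤ A) (hl : ∀ a ∈ A, ∀ c ∈ C, a * c ∈ C)
    (hr : ∀ a ∈ A, ∀ c ∈ C, c * a ∈ C) {p : B} (hp : p ∈ A) :
    IsClosedIdeal A
      (Submodule.span ℂ {x : B | ∃ a ∈ C, ∃ b ∈ C, x = a * p * b}).topologicalClosure := by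
  set s : Set B := {x : B | ∃ a ∈ C, ∃ b ∈ C, x = a * p * b} with hs
  have hbase : (Submodule.span ℂ s) ≤ A.toSubmodule := Submodule.span_le.2 (by
    rintro _ ⟨a, ha, b, hb, rfl⟩
    exact mul_mem (S := NonUnitalStarSubalgebra ℂ B)
      (mul_mem (S := NonUnitalStarSubalgebra ℂ B) (hCA ha) hp) (hCA hb))
  refine ⟨Submodule.isClosed_topologicalClosure _,
    fun x hx => closure_minimal (t := (A : Set B)) hbase hA hx, ?_, ?_⟩
  · intro a ha x hx
    refine map_mem_closure (f := fun x => a * x) (by fun_prop) hx fun y hy => ?_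
    change a * y ∈ Submodule.span ℂ s
    induction hy using Submodule.span_induction with
    | mem y hy =>
      obtain ⟨c, hc, d, hd, rfl⟩ := hy
      exact Submodule.subset_span ⟨a * c, hl a ha c hc, d, hd, by simp only [mul_assoc]⟩
    | zero => simp
    | add y z _ _ h1 h2 =>
      rw [mul_add]
      exact add_mem h1 h2
    | smul c y _ h =>
      rw [mul_smul_comm]
      exact Submodule.smul_mem _ c h
  · intro a ha x hx
    refine map_mem_closure (f := fun x => x * a) (by fun_prop) hx fun y hy => ?_
    change y * a ∈ Submodule.span ℂ s
    induction hy using Submodule.span_induction with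
    | mem y hy =>
      obtain ⟨c, hc, d, hd, rfl⟩ := hy
      exact Submodule.subset_span ⟨c, hc, d * a, hr a ha d hd, by simp only [mul_assoc]⟩
    | zero => simp
    | add y z _ _ h1 h2 =>
      rw [add_mul]
      exact add_mem h1 h2
    | smul c y _ h =>
      rw [smul_mul_assoc]
      exact Submodule.smul_mem _ c h

/-- A positive element of a closed star subalgebra has a square root in it. -/
theorem exists_mem_star_mul_self_eq {C : NonUnitalStarSubalgebra ℂ B} (hC : IsClosed (C : Set B))
    {x : B} (hx : star x * x ∈ C) : ∃ c ∈ C, star x * x = star c * c := by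
  let _ := CStarAlgebra.spectralOrder B
  let _ := CStarAlgebra.spectralOrderedRing B
  have h0 : 0 ≤ star x * x := star_mul_self_nonneg x
  refine ⟨CFC.sqrt (star x * x), ?_, ?_⟩
  · rw [CFC.sqrt_eq_real_sqrt _ h0]
    have := hC
    exact cfcₙ_mem (𝕜 := ℝ) (𝕜' := ℂ) (s := C) Real.sqrt hx
  · rw [(CFC.sqrt_nonneg (star x * x)).isSelfAdjoint.star_eq, CFC.sqrt_mul_sqrt_self _ h0]

/-- Idempotence replaces the existential by closed equations, which makes the corner visibly closed.
-/
theorem mem_cornerSubalgebra_iff {C : NonUnitalStarSubalgebra ℂ B} {p : B}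
    (hp : IsStarProjection p) (hpC : ∀ c ∈ C, p * c ∈ C) {x : B} :
    x ∈ cornerSubalgebra C p hp.isSelfAdjoint hpC ↔ x ∈ C ∧ p * x = x ∧ x * p = x := by
  have hpp : p * p = p := hp.isIdempotentElem
  constructor
  · rintro ⟨c, hc, rfl⟩
    refine ⟨?_, by simp only [← mul_assoc, hpp], by simp only [mul_assoc, hpp]⟩
    -- Only left multiplication by `p` is given, so right multiplication is obtained by taking
    -- adjoints.
    have h1 := hpC _ (star_mem (hpC c hc))
    simpa [hp.isSelfAdjoint.star_eq, mul_assoc] using star_mem h1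
  · rintro ⟨hx, h1, h2⟩
    exact ⟨x, hx, by rw [h1, h2]⟩

theorem isClosed_cornerSubalgebra {C : NonUnitalStarSubalgebra ℂ B} (hC : IsClosed (C : Set B))
    {p : B} (hp : IsStarProjection p) (hpC : ∀ c ∈ C, p * c ∈ C) :
    IsClosed (cornerSubalgebra C p hp.isSelfAdjoint hpC : Set B) := by
  have : (cornerSubalgebra C p hp.isSelfAdjoint hpC : Set B) =
      (C : Set B) ∩ ({x | p * x = x} ∩ {x | x * p = x}) := by
    ext x
    exact mem_cornerSubalgebra_iff hp hpC
  rw [this]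
  exact hC.inter ((isClosed_eq (by fun_prop) (by fun_prop)).inter
    (isClosed_eq (by fun_prop) (by fun_prop)))

end CStarGenerated

/-! ### The imprimitivity bimodule of a full corner -/

section FullCorner

variable {B : Type u} [NonUnitalCStarAlgebra B]

/-- The right ideal `p C`, as the subspace of those elements of `C` that `p` fixes. -/
def cornerModule (C : NonUnitalStarSubalgebra ℂ B) (p : B) : Submodule ℂ B where
  carrier := {x | x ∈ C ∧ p * x = x}
  add_mem' := fun hx hy => ⟨add_mem hx.1 hy.1, by rw [mul_add, hx.2, hy.2]⟩
  zero_mem' := ⟨zero_mem _, mul_zero _⟩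
  smul_mem' := fun c _ hx => ⟨C.smul_mem c hx.1, by rw [mul_smul_comm, hx.2]⟩

theorem isClosed_cornerModule {C : NonUnitalStarSubalgebra ℂ B} (hC : IsClosed (C : Set B))
    (p : B) : IsClosed (cornerModule C p : Set B) :=
  hC.inter (isClosed_eq (f := fun x => p * x) (g := fun x => x) (by fun_prop) (by fun_prop))

/-- Density of a linear span in a subalgebra can be tested in the ambient algebra. -/
theorem dense_span_subtype {C : NonUnitalStarSubalgebra ℂ B} {s : Set C}
    (h : (C : Set B) ⊆ closure (Submodule.span ℂ (Subtype.val '' s) : Set B)) :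
    Dense (Submodule.span ℂ s : Set C) := by
  intro x
  rw [Topology.IsInducing.subtypeVal.closure_eq_preimage_closure_image]
  have : (Subtype.val '' (Submodule.span ℂ s : Set C)) =
      (Submodule.span ℂ (Subtype.val '' s) : Set B) := by
    have := Submodule.map_span C.toSubmodule.subtype s
    exact congrArg (fun M : Submodule ℂ B => (M : Set B)) this
  exact (congrArg (fun t => (x : B) ∈ closure t) this).mpr (h x.2)

variable {A : Type u} [NonUnitalCStarAlgebra A]

/-- A C⋆-algebra isomorphic to a full corner `p C p` is Morita equivalent to `C`. -/
theorem moritaEquivalent_of_fullCorner (C : NonUnitalStarSubalgebra ℂ B)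
    [hC : IsClosed (C : Set B)] {p : B} (hp : IsStarProjection p) (hpC : p ∈ C)
    (hpC' : ∀ c ∈ C, p * c ∈ C)
    (e : A ≃⋆ₐ[ℂ] cornerSubalgebra C p hp.isSelfAdjoint hpC') (hfull : IsFullCorner C p) :
    MoritaEquivalent A C := by
  have : IsClosed (cornerSubalgebra C p hp.isSelfAdjoint hpC' : Set B) :=
    isClosed_cornerSubalgebra hC hp hpC'
  have hpp : p * p = p := hp.isIdempotentElem
  have hps : star p = p := hp.isSelfAdjoint.star_eq
  have hstar : ∀ x : cornerModule C p, star (x : B) * p = star (x : B) := fun x => by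
    conv_rhs => rw [← x.2.2]
    rw [star_mul, hps]
  have hA : ∀ a : A, (e a : B) ∈ C ∧ p * (e a : B) = e a ∧ (e a : B) * p = e a := fun a =>
    (mem_cornerSubalgebra_iff hp hpC').1 (e a).2
  have hcomplete : CompleteSpace (cornerModule C p) :=
    (isClosed_cornerModule hC p).completeSpace_coe
  -- On `p C`, `x y⋆` lies in `p C p` and is transported to `A` by `e`; the `C`-valued inner product
  -- is `x⋆ y`.
  let ip : cornerModule C p → cornerModule C p → cornerSubalgebra C p hp.isSelfAdjoint hpC' :=
    fun x y => ⟨(x : B) * star (y : B), (mem_cornerSubalgebra_iff hp hpC').2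
      ⟨mul_mem x.2.1 (star_mem y.2.1), by rw [← mul_assoc, x.2.2], by rw [mul_assoc, hstar]⟩⟩
  have eip : ∀ x y, (e (e.symm (ip x y)) : B) = (x : B) * star (y : B) := fun x y => by
    rw [StarAlgEquiv.apply_symm_apply]
  have hinj : ∀ {a b : A}, (e a : B) = (e b : B) → a = b := fun h =>
    e.injective (Subtype.ext h)
  have hestar : ∀ a : A, (e (star a) : B) = star (e a : B) := fun a =>
    congrArg Subtype.val (e.map_star' a)
  refine ⟨cornerModule C p, inferInstance, inferInstance, hcomplete, ⟨?_⟩⟩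
  refine
  { lact := LinearMap.mk₂ ℂ (fun a x => ⟨(e a : B) * x, mul_mem (hA a).1 x.2.1, by
        rw [← mul_assoc, (hA a).2.1]⟩)
      (fun a a' x => Subtype.ext (by simp [add_mul]))
      (fun c a x => Subtype.ext (by simp [smul_mul_assoc]))
      (fun a x x' => Subtype.ext (by simp [mul_add]))
      (fun c a x => Subtype.ext (by simp [mul_smul_comm]))
    ract := LinearMap.mk₂ ℂ (fun x b => ⟨(x : B) * (b : B), mul_mem x.2.1 b.2, by
        rw [← mul_assoc, x.2.2]⟩)
      (fun x x' b => Subtype.ext (by simp [add_mul]))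
      (fun c x b => Subtype.ext (by simp [smul_mul_assoc]))
      (fun x b b' => Subtype.ext (by simp [mul_add]))
      (fun c x b => Subtype.ext (by simp [mul_smul_comm]))
    linner := LinearMap.mk₂'ₛₗ (RingHom.id ℂ) (starRingEnd ℂ) (fun x y => e.symm (ip x y))
      (fun x x' y => hinj (by simp [ip, add_mul]))
      (fun c x y => hinj (by simp [ip, smul_mul_assoc]))
      (fun x y y' => hinj (by simp [ip, mul_add]))
      (fun c x y => hinj (by simp [ip, mul_smul_comm]))
    rinner := LinearMap.mk₂'ₛₗ (starRingEnd ℂ) (RingHom.id ℂ)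
      (fun x y => ⟨star (x : B) * (y : B), mul_mem (star_mem x.2.1) y.2.1⟩)
      (fun x x' y => Subtype.ext (by simp [add_mul]))
      (fun c x y => Subtype.ext (by simp [smul_mul_assoc]))
      (fun x y y' => Subtype.ext (by simp [mul_add]))
      (fun c x y => Subtype.ext (by simp [mul_smul_comm]))
    mul_lact := fun a a' x => Subtype.ext (by simp [mul_assoc])
    ract_mul := fun x b b' => Subtype.ext (by simp [mul_assoc])
    lact_ract := fun a x b => Subtype.ext (by simp [mul_assoc])
    linner_lact := fun a x y => hinj (by simp [ip, mul_assoc])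
    rinner_ract := fun x y b => Subtype.ext (by simp [mul_assoc])
    star_linner := fun x y => hinj (by simp [ip, hestar])
    star_rinner := fun x y => Subtype.ext (by simp)
    linner_self_nonneg := ?_
    rinner_self_nonneg := ?_
    norm_linner_self := ?_
    norm_rinner_self := ?_
    linner_full := ?_
    rinner_full := ?_
    rinner_lact := fun a x y => Subtype.ext (by simp [hestar, mul_assoc])
    linner_ract := fun x y b => hinj (by simp [ip, mul_assoc])
    linner_lact_eq_ract_rinner := fun x y z => Subtype.ext (by simp [ip, mul_assoc]) }
  · intro x
    obtain ⟨c, hc, h⟩ := exists_mem_star_mul_self_eq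
      (isClosed_cornerSubalgebra hC hp hpC') (x := star (x : B)) (by
        rw [star_star]; exact (ip x x).2)
    refine ⟨e.symm ⟨c, hc⟩, hinj ?_⟩
    simpa [ip, hestar] using h
  · intro x
    obtain ⟨c, hc, h⟩ := exists_mem_star_mul_self_eq hC (x := (x : B))
      (mul_mem (star_mem x.2.1) x.2.1)
    exact ⟨⟨c, hc⟩, Subtype.ext h⟩
  · intro x
    change ‖e.symm (ip x x)‖ = _
    rw [StarAlgEquiv.norm_map]
    change ‖(x : B) * star (x : B)‖ = ‖(x : B)‖ ^ 2
    rw [CStarRing.norm_self_mul_star, sq]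
  · intro x
    change ‖star (x : B) * (x : B)‖ = ‖(x : B)‖ ^ 2
    rw [CStarRing.norm_star_mul_self, sq]
  -- Since `p ∈ C`, each `a` is itself the inner product of `e a` with `p`; no closure is needed.
  · have : ∀ a : A, a ∈ Submodule.span ℂ {a : A | ∃ x y, a = e.symm (ip x y)} := fun a =>
      Submodule.subset_span ⟨⟨e a, (hA a).1, (hA a).2.1⟩, ⟨p, hpC, hpp⟩, hinj (by
        rw [eip]; simp [hps, (hA a).2.2])⟩
    exact fun a => subset_closure (this a)
  -- Fullness of the corner enters here, through `a p b = (p a⋆)⋆ (p b)`.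
  · refine dense_span_subtype ?_
    rw [← hfull]
    refine closure_mono (Submodule.span_mono ?_)
    rintro _ ⟨a, ha, b, hb, rfl⟩
    refine ⟨⟨a * p * b, mul_mem (mul_mem ha hpC) hb⟩,
      ⟨⟨p * star a, mul_mem hpC (star_mem ha), by rw [← mul_assoc, hpp]⟩,
       ⟨p * b, mul_mem hpC hb, by rw [← mul_assoc, hpp]⟩, Subtype.ext ?_⟩, rfl⟩
    change a * p * b = star (p * star a) * (p * b)
    rw [star_mul, star_star, hps, mul_assoc a p (p * b), ← mul_assoc p p b, hpp, mul_assoc]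

end FullCorner

/-! ### Coordinates on `ℓ²` and composition operators -/

section Coordinates

open ContinuousLinearMap

variable {α β : Type u}

/-- The coordinate of a vector of `ℓ²` as an inner product with a basis vector. -/
theorem ellTwo_apply_eq_inner [DecidableEq α] (f : lp (fun _ : α => ℂ) 2) (r : α) :
    f r = inner ℂ (lp.single 2 r (1 : ℂ)) f := by
  rw [lp.inner_single_left]; simp

theorem adjoint_apply_coord [DecidableEq α]
    (T : lp (fun _ : α => ℂ) 2 →L[ℂ] lp (fun _ : β => ℂ) 2) (g : lp (fun _ : β => ℂ) 2) (r : α) :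
    adjoint T g r = inner ℂ (T (lp.single 2 r (1 : ℂ))) g := by
  rw [ellTwo_apply_eq_inner, adjoint_inner_right]

/-- The coisometry `f ↦ f ∘ ι` on `ℓ²`, for an injective map `ι`. -/
def ellTwoComp (ι : α → β) (hι : Function.Injective ι) :
    lp (fun _ : β => ℂ) 2 →L[ℂ] lp (fun _ : α => ℂ) 2 :=
  LinearMap.mkContinuous
    { toFun := fun f => ⟨fun r => f (ι r), memℓp_gen
        (((lp.memℓp f).summable (by norm_num)).comp_injective hι)⟩
      map_add' := fun _ _ => rfl
      map_smul' := fun _ _ => rfl } 1 (fun f => by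
    rw [one_mul]
    refine lp.norm_le_of_tsum_le (by norm_num) (norm_nonneg _) ?_
    rw [lp.norm_rpow_eq_tsum (by norm_num) f]
    exact tsum_comp_le_tsum_of_inj ((lp.memℓp f).summable (by norm_num))
      (fun x => by positivity) hι)

@[simp]
theorem ellTwoComp_apply (ι : α → β) (hι : Function.Injective ι) (f : lp (fun _ : β => ℂ) 2)
    (r : α) : ellTwoComp ι hι f r = f (ι r) := rfl

theorem adjoint_ellTwoComp_apply (ι : α → β) (hι : Function.Injective ι)
    (g : lp (fun _ : α => ℂ) 2) (r : α) : adjoint (ellTwoComp ι hι) g (ι r) = g r := by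
  classical
  rw [adjoint_apply_coord, ellTwo_apply_eq_inner]
  congr 1
  ext q
  simp [Pi.single_apply, hι.eq_iff]

theorem adjoint_ellTwoComp_apply_of_notMem (ι : α → β) (hι : Function.Injective ι)
    (g : lp (fun _ : α => ℂ) 2) {x : β} (hx : ∀ r, ι r ≠ x) :
    adjoint (ellTwoComp ι hι) g x = 0 := by
  classical
  rw [adjoint_apply_coord]
  have : ellTwoComp ι hι (lp.single 2 x (1 : ℂ)) = 0 := by
    ext q
    simp [hx]
  rw [this, inner_zero_left]

theorem ellTwoComp_comp_adjoint (ι : α → β) (hι : Function.Injective ι) :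
    ellTwoComp ι hι ∘L adjoint (ellTwoComp ι hι) = 1 := by
  ext g r
  exact adjoint_ellTwoComp_apply ι hι g r

end Coordinates

/-! ### The isometries of the Toeplitz algebra -/

section Toeplitz

open ContinuousLinearMap

variable {Γ : Type u} [AddCommGroup Γ] [LinearOrder Γ]

theorem shiftT_apply_of_le {t : Γ} (f : EllTwo (Set.Ici (0 : Γ))) (r : Set.Ici (0 : Γ))
    (h : 0 ≤ (r : Γ) - t) : shiftT t f r = f ⟨(r : Γ) - t, h⟩ :=
  dif_pos h

theorem shiftT_apply_of_not_le {t : Γ} (f : EllTwo (Set.Ici (0 : Γ))) (r : Set.Ici (0 : Γ))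
    (h : ¬ 0 ≤ (r : Γ) - t) : shiftT t f r = 0 :=
  dif_neg h

theorem shiftT_zero : shiftT (0 : Γ) = 1 := by
  ext f r
  rw [shiftT_apply_of_le f r (by rw [sub_zero]; exact r.2)]
  simp

variable (Γ) in
/-- The linear span of the operators `T_a T_b⋆`. -/
def wienerHopfSpan : Submodule ℂ (BEllTwo (Set.Ici (0 : Γ))) :=
  Submodule.span ℂ {x | ∃ a b : Γ, 0 ≤ a ∧ 0 ≤ b ∧ x = shiftT a * star (shiftT b)}

theorem mul_mem_wienerHopfSpan {x y : BEllTwo (Set.Ici (0 : Γ))}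
    (h : ∀ a b : Γ, 0 ≤ a → 0 ≤ b → x * (shiftT a * star (shiftT b)) ∈ wienerHopfSpan Γ)
    (hy : y ∈ wienerHopfSpan Γ) : x * y ∈ wienerHopfSpan Γ := by
  induction hy using Submodule.span_induction with
  | mem y hy =>
    obtain ⟨a, b, ha, hb, rfl⟩ := hy
    exact h a b ha hb
  | zero => simp
  | add y z _ _ h1 h2 =>
    rw [mul_add]
    exact add_mem h1 h2
  | smul c y _ h =>
    rw [mul_smul_comm]
    exact Submodule.smul_mem _ c h

variable [IsOrderedAddMonoid Γ]

theorem star_shiftT_apply {t : Γ} (ht : 0 ≤ t) (f : EllTwo (Set.Ici (0 : Γ)))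
    (r : Set.Ici (0 : Γ)) :
    star (shiftT t) f r = f ⟨(r : Γ) + t, add_nonneg r.2 ht⟩ := by
  classical
  rw [star_eq_adjoint, adjoint_apply_coord, ellTwo_apply_eq_inner]
  congr 1
  have h := truncShift_single (Set.Ici (0 : Γ)) t r
  rw [dif_pos (Set.mem_Ici.2 (add_nonneg (Set.mem_Ici.1 r.2) ht))] at h
  unfold shiftT
  convert h

theorem star_shiftT_mul_self {t : Γ} (ht : 0 ≤ t) : star (shiftT t) * shiftT t = 1 := by
  ext f r
  change star (shiftT t) (shiftT t f) r = f r
  rw [star_shiftT_apply ht, shiftT_apply_of_le _ _ (by rw [add_sub_cancel_right]; exact r.2)]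
  simp

theorem shiftT_mul {a b : Γ} (hb : 0 ≤ b) :
    shiftT a * shiftT b = shiftT (a + b) := by
  ext f r
  change shiftT a (shiftT b f) r = shiftT (a + b) f r
  by_cases h : 0 ≤ (r : Γ) - (a + b)
  · have h1 : 0 ≤ (r : Γ) - a := h.trans (by gcongr; exact le_add_of_nonneg_right hb)
    rw [shiftT_apply_of_le _ _ h, shiftT_apply_of_le _ _ h1,
      shiftT_apply_of_le _ _ (by simpa [sub_sub] using h)]
    simp [sub_sub]
  · rw [shiftT_apply_of_not_le _ _ h]
    by_cases h1 : 0 ≤ (r : Γ) - a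
    · rw [shiftT_apply_of_le _ _ h1, shiftT_apply_of_not_le _ _ (by simpa [sub_sub] using h)]
    · rw [shiftT_apply_of_not_le _ _ h1]

theorem shiftT_comm {a b : Γ} (ha : 0 ≤ a) (hb : 0 ≤ b) :
    shiftT a * shiftT b = shiftT b * shiftT a := by
  rw [shiftT_mul hb, shiftT_mul ha, add_comm]

/-- Factor `T_b = T_a T_{b-a}`. Because the order is total, this or its mirror image always reduces
`T_a⋆ T_b` to one shift or one adjoint. -/
theorem star_shiftT_mul_shiftT_of_le {a b : Γ} (ha : 0 ≤ a) (hab : a ≤ b) :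
    star (shiftT a) * shiftT b = shiftT (b - a) := by
  rw [← add_sub_cancel a b, ← shiftT_mul (sub_nonneg.2 hab), ← mul_assoc,
    star_shiftT_mul_self ha, one_mul, add_sub_cancel]

theorem star_shiftT_mul_shiftT_of_ge {a b : Γ} (hb : 0 ≤ b) (hab : b ≤ a) :
    star (shiftT a) * shiftT b = star (shiftT (a - b)) := by
  rw [← star_shiftT_mul_shiftT_of_le hb hab, star_mul, star_star]

theorem isStarProjection_defectProj {s : Γ} (hs : 0 ≤ s) : IsStarProjection (defectProj s) := by
  refine ⟨?_, isSelfAdjoint_defectProj s⟩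
  refine IsIdempotentElem.one_sub ?_
  rw [IsIdempotentElem, mul_assoc, ← mul_assoc (star (shiftT s)), star_shiftT_mul_self hs,
    one_mul]

/-- As `T_s⋆ T_s = 1`, the projection is the commutator of `T_s⋆` and `T_s`. -/
theorem defectProj_mem_toeplitzCommutatorIdeal {s : Γ} (hs : 0 ≤ s) :
    defectProj s ∈ toeplitzCommutatorIdeal Γ := by
  have h := commutator_mem_commutatorIdeal (A := toeplitzAlgebra Γ)
    (star_mem (shiftT_mem_toeplitzAlgebra hs)) (shiftT_mem_toeplitzAlgebra hs)
  rwa [star_shiftT_mul_self hs] at h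

theorem defectProj_mul_shiftT {s t : Γ} (hs : 0 ≤ s) (hst : s ≤ t) :
    defectProj s * shiftT t = 0 := by
  rw [← add_sub_cancel s t, ← shiftT_mul (sub_nonneg.2 hst), defectProj, sub_mul, one_mul,
    mul_assoc (shiftT s), ← mul_assoc (star (shiftT s)), star_shiftT_mul_self hs, one_mul, sub_self]

/-- For `a ≥ 0` this reflects `[0, a + b) = [0, a) ∪ (a + [0, b))`; it drives the induction over
multiples of `s`. -/
theorem defectProj_add {a b : Γ} (hb : 0 ≤ b) :
    defectProj (a + b) = defectProj a + shiftT a * defectProj b * star (shiftT a) := by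
  rw [defectProj, ← shiftT_mul hb, star_mul, defectProj, defectProj]
  noncomm_ring

/-- An ideal containing the larger projection thus contains the smaller. -/
theorem defectProj_eq_mul {t u : Γ} (ht : 0 ≤ t) (htu : t ≤ u) :
    defectProj t = defectProj t * defectProj u := by
  conv_rhs => rw [defectProj.eq_1 u]
  rw [mul_sub, mul_one, ← mul_assoc, defectProj_mul_shiftT ht htu, zero_mul, sub_zero]

theorem defectProj_mem_toeplitzAlgebra {s : Γ} (hs : 0 ≤ s) : defectProj s ∈ toeplitzAlgebra Γ :=
  commutatorIdeal_le _ (defectProj_mem_toeplitzCommutatorIdeal hs)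

/-- If every positive element is dominated by a multiple of `s`, then the corner of the commutator
ideal defined by `1 - T_s T_s⋆` is full. -/
theorem isFullCorner_defectProj {s : Γ} (hs : 0 ≤ s) (h : ∀ t : Γ, 0 ≤ t → ∃ n : ℕ, t ≤ n • s) :
    IsFullCorner (toeplitzCommutatorIdeal Γ) (defectProj s) := by
  set C := toeplitzCommutatorIdeal Γ with hC
  set p := defectProj s with hp
  have hpp : p * p = p := (isStarProjection_defectProj hs).isIdempotentElem
  have hpC : p ∈ C := defectProj_mem_toeplitzCommutatorIdeal hs
  have hJ := isClosedIdeal_closure_span_mul (A := toeplitzAlgebra Γ) (C := C)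
    (toeplitzAlgebra_isClosed Γ) (commutatorIdeal_le _)
    (fun _ ha _ hc => mul_mem_commutatorIdeal_left ha hc)
    (fun _ ha _ hc => mul_mem_commutatorIdeal_right ha hc)
    (defectProj_mem_toeplitzAlgebra hs)
  set J := (Submodule.span ℂ {x | ∃ a ∈ C, ∃ b ∈ C, x = a * p * b}).topologicalClosure with hJdef
  have hpJ : p ∈ J := subset_closure (Submodule.subset_span ⟨p, hpC, p, hpC, by rw [hpp, hpp]⟩)
  have hn : ∀ n : ℕ, defectProj (n • s) ∈ J := by
    intro n
    induction n with
    | zero => simp [defectProj, shiftT_zero]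
    | succ n ih =>
      have hns : 0 ≤ n • s := nsmul_nonneg hs n
      rw [succ_nsmul, defectProj_add hs]
      exact J.add_mem ih (hJ.mul_mem_right _ (star_mem (shiftT_mem_toeplitzAlgebra hns)) _
        (hJ.mul_mem_left _ (shiftT_mem_toeplitzAlgebra hns) _ hpJ))
  have hall : ∀ t : Γ, 0 ≤ t → defectProj t ∈ J := by
    intro t ht
    obtain ⟨n, hle⟩ := h t ht
    rw [defectProj_eq_mul ht hle]
    exact hJ.mul_mem_left _ (defectProj_mem_toeplitzAlgebra ht) _ (hn n)
  have hcomm : ∀ a b : Γ, 0 ≤ a → 0 ≤ b →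
      star (shiftT a) * shiftT b - shiftT b * star (shiftT a) ∈ J := by
    intro a b ha hb
    -- `T_a` and `T_b` commute, so `T_a⋆ T_b T_a T_a⋆ = T_b T_a⋆`.
    have : star (shiftT a) * shiftT b - shiftT b * star (shiftT a) =
        star (shiftT a) * shiftT b * defectProj a := by
      have h1 : star (shiftT a) * shiftT b * (shiftT a * star (shiftT a)) =
          shiftT b * star (shiftT a) := by
        rw [← mul_assoc, mul_assoc (star (shiftT a)), shiftT_comm hb ha,
          ← mul_assoc (star (shiftT a)), star_shiftT_mul_self ha, one_mul]
      rw [defectProj, mul_sub, mul_one, h1]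
    rw [this]
    exact hJ.mul_mem_left _ (mul_mem (star_mem (shiftT_mem_toeplitzAlgebra ha))
      (shiftT_mem_toeplitzAlgebra hb)) _ (hall a ha)
  have habs : IsCommutatorAbsorbing (toeplitzAlgebra Γ) J := by
    refine IsClosedIdeal.isCommutatorAbsorbing_of_generators hJ ?_
    have hstar : ∀ x ∈ star {x : BEllTwo (Set.Ici (0 : Γ)) | ∃ s : Γ, 0 ≤ s ∧ x = shiftT s},
        ∃ s : Γ, 0 ≤ s ∧ x = star (shiftT s) := by
      rintro x ⟨a, ha, hx⟩
      exact ⟨a, ha, by rw [← hx, star_star]⟩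
    intro x hx y hy
    rcases hx with ⟨a, ha, rfl⟩ | hx <;> rcases hy with ⟨b, hb, rfl⟩ | hy
    · simp [shiftT_comm ha hb]
    · obtain ⟨b, hb, rfl⟩ := hstar y hy
      simpa using J.neg_mem (hcomm b a hb ha)
    · obtain ⟨a, ha, rfl⟩ := hstar x hx
      exact hcomm a b ha hb
    · obtain ⟨a, ha, rfl⟩ := hstar x hx
      obtain ⟨b, hb, rfl⟩ := hstar y hy
      simp [← star_mul, shiftT_comm ha hb]
  refine Set.Subset.antisymm (closure_minimal ?_ (toeplitzCommutatorIdeal_isClosed Γ))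
    fun x hx => hx J habs
  change Submodule.span ℂ _ ≤ C.toSubmodule
  refine Submodule.span_le.2 ?_
  rintro _ ⟨a, ha, b, hb, rfl⟩
  exact mul_mem (S := NonUnitalStarSubalgebra ℂ _)
    (mul_mem (S := NonUnitalStarSubalgebra ℂ _) ha hpC) hb

/-- The Toeplitz algebra is the closed linear span of the operators `T_a T_b⋆`. -/
theorem toeplitzAlgebra_le_closure_wienerHopfSpan {x : BEllTwo (Set.Ici (0 : Γ))}
    (hx : x ∈ toeplitzAlgebra Γ) : x ∈ (wienerHopfSpan Γ).topologicalClosure := by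
  set L := (wienerHopfSpan Γ).topologicalClosure with hL
  -- It suffices that `L` absorbs left multiplication by generators, because `1 = T_0 T_0⋆` lies in
  -- `L`.
  have key : ∀ x ∈ toeplitzAlgebra Γ, ∀ y ∈ L, x * y ∈ L := by
    refine cstarGenerated_induction ?_ ?_ ?_ ?_ ?_ ?_ ?_
    · rintro _ ⟨c, hc, rfl⟩ y hy
      refine map_mem_closure (f := fun y => shiftT c * y) (by fun_prop) hy fun z hz =>
        mul_mem_wienerHopfSpan (fun a b ha hb => ?_) hz
      rw [← mul_assoc, shiftT_mul ha]
      exact Submodule.subset_span ⟨c + a, b, add_nonneg hc ha, hb, rfl⟩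
    · rintro _ ⟨c, hc, rfl⟩ y hy
      refine map_mem_closure (f := fun y => star (shiftT c) * y) (by fun_prop) hy fun z hz =>
        mul_mem_wienerHopfSpan (fun a b ha hb => ?_) hz
      rw [← mul_assoc]
      rcases le_total c a with hca | hca
      · rw [star_shiftT_mul_shiftT_of_le hc hca]
        exact Submodule.subset_span ⟨a - c, b, sub_nonneg.2 hca, hb, rfl⟩
      · rw [star_shiftT_mul_shiftT_of_ge ha hca, ← star_mul, shiftT_mul (sub_nonneg.2 hca)]
        exact Submodule.subset_span
          ⟨0, b + (c - a), le_rfl, add_nonneg hb (sub_nonneg.2 hca), by rw [shiftT_zero, one_mul]⟩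
    · intro y _
      simp
    · intro x _ y _ h1 h2 z hz
      rw [add_mul]
      exact L.add_mem (h1 z hz) (h2 z hz)
    · intro x _ y _ h1 h2 z hz
      rw [mul_assoc]
      exact h1 _ (h2 z hz)
    · intro c x _ h z hz
      rw [smul_mul_assoc]
      exact L.smul_mem c (h z hz)
    · simp only [Set.ofPred_forall]
      exact isClosed_biInter fun y _ => (Submodule.isClosed_topologicalClosure _).preimage
        (f := fun x => x * y) (by fun_prop)
  simpa using key x hx 1 (subset_closure (Submodule.subset_span
    ⟨0, 0, le_rfl, le_rfl, by simp [shiftT_zero]⟩))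

end Toeplitz

/-! ### The order ideal generated by a positive element -/

section OrderIdeal

variable {Γ : Type u} [AddCommGroup Γ] [LinearOrder Γ] [IsOrderedAddMonoid Γ]

/-- The order ideal generated by a positive element `s`. -/
def orderIdealClosure (s : Γ) : AddSubgroup Γ where
  carrier := {x | ∃ n : ℕ, |x| ≤ n • s}
  add_mem' := by
    rintro x y ⟨m, hm⟩ ⟨n, hn⟩
    exact ⟨m + n, (abs_add_le x y).trans (by rw [add_nsmul]; exact add_le_add hm hn)⟩
  zero_mem' := ⟨0, by simp⟩
  neg_mem' := by
    rintro x ⟨n, hn⟩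
    exact ⟨n, by rwa [abs_neg]⟩

theorem mem_orderIdealClosure_iff {s t : Γ} (ht : 0 ≤ t) :
    t ∈ orderIdealClosure s ↔ ∃ n : ℕ, t ≤ n • s := by
  change (∃ n : ℕ, |t| ≤ n • s) ↔ _
  rw [abs_of_nonneg ht]

theorem isOrderIdeal_orderIdealClosure (s : Γ) :
    IsOrderIdeal (orderIdealClosure s) := by
  rintro x ⟨n, hn⟩ y hy hyx
  exact (mem_orderIdealClosure_iff hy).2 ⟨n, (hyx.trans (le_abs_self x)).trans hn⟩

theorem self_mem_orderIdealClosure {s : Γ} (hs : 0 ≤ s) : s ∈ orderIdealClosure s :=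
  (mem_orderIdealClosure_iff hs).2 ⟨1, by rw [one_nsmul]⟩

theorem isLeast_orderIdealClosure {s : Γ} (hs : 0 ≤ s) :
    IsLeast {J : AddSubgroup Γ | IsOrderIdeal J ∧ s ∈ J} (orderIdealClosure s) := by
  refine ⟨⟨isOrderIdeal_orderIdealClosure s, self_mem_orderIdealClosure hs⟩, ?_⟩
  rintro J ⟨hJ, hsJ⟩ x ⟨n, hn⟩
  have : |x| ∈ J := hJ _ (J.nsmul_mem hsJ n) _ (abs_nonneg x) hn
  rcases abs_choice x with h | h <;> rw [h] at this
  · exact this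
  · simpa using J.neg_mem this

end OrderIdeal

/-! ### Truncated shifts as a corner of the Toeplitz algebra -/

section Corner

open ContinuousLinearMap

variable {Γ : Type u} [AddCommGroup Γ] [LinearOrder Γ] {I : AddSubgroup Γ} {s : Γ}

/-- The inclusion of `[0, s)` in the positive cone of an order ideal that contains `s`. -/
def icoInclusion (hI : IsOrderIdeal I) (hsI : s ∈ I) (r : Set.Ico 0 s) : Set.Ici (0 : I) :=
  ⟨⟨r, hI s hsI r r.2.1 r.2.2.le⟩, r.2.1⟩

theorem icoInclusion_injective (hI : IsOrderIdeal I) (hsI : s ∈ I) :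
    Function.Injective (icoInclusion hI hsI) := fun _ _ h =>
  Subtype.ext (congrArg (fun x : Set.Ici (0 : I) => ((x : I) : Γ)) h)

/-- The restriction map `ℓ²(I⁺) → ℓ²([0, s))`. -/
def icoRestrict (hI : IsOrderIdeal I) (hsI : s ∈ I) :
    EllTwo (Set.Ici (0 : I)) →L[ℂ] EllTwo (Set.Ico 0 s) :=
  ellTwoComp (icoInclusion hI hsI) (icoInclusion_injective hI hsI)

theorem icoRestrict_comp_adjoint (hI : IsOrderIdeal I) (hsI : s ∈ I) :
    icoRestrict hI hsI ∘L adjoint (icoRestrict hI hsI) = 1 :=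
  ellTwoComp_comp_adjoint _ _

theorem adjoint_icoRestrict_apply_of_lt (hI : IsOrderIdeal I) (hsI : s ∈ I)
    (g : EllTwo (Set.Ico 0 s)) (x : Set.Ici (0 : I)) (hx : ((x : I) : Γ) ∈ Set.Ico 0 s) :
    adjoint (icoRestrict hI hsI) g x = g ⟨((x : I) : Γ), hx⟩ :=
  adjoint_ellTwoComp_apply _ (icoInclusion_injective hI hsI) g ⟨((x : I) : Γ), hx⟩

theorem adjoint_icoRestrict_apply_of_le (hI : IsOrderIdeal I) (hsI : s ∈ I)
    (g : EllTwo (Set.Ico 0 s)) (x : Set.Ici (0 : I)) (hx : s ≤ ((x : I) : Γ)) :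
    adjoint (icoRestrict hI hsI) g x = 0 := by
  refine adjoint_ellTwoComp_apply_of_notMem _ (icoInclusion_injective hI hsI) g fun r hr => ?_
  have : (r : Γ) = ((x : I) : Γ) := congrArg (fun x : Set.Ici (0 : I) => ((x : I) : Γ)) hr
  exact absurd r.2.2 (not_lt.2 (this ▸ hx))

/-- Compression of operators on `ℓ²(I⁺)` to `ℓ²([0, s))`. -/
def icoCompress (hI : IsOrderIdeal I) (hsI : s ∈ I) (x : BEllTwo (Set.Ici (0 : I))) :
    BEllTwo (Set.Ico 0 s) :=
  icoRestrict hI hsI ∘L x ∘L adjoint (icoRestrict hI hsI)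

/-- Extension by zero of operators on `ℓ²([0, s))` to `ℓ²(I⁺)`. -/
def icoExtend (hI : IsOrderIdeal I) (hsI : s ∈ I) (x : BEllTwo (Set.Ico 0 s)) :
    BEllTwo (Set.Ici (0 : I)) :=
  adjoint (icoRestrict hI hsI) ∘L x ∘L icoRestrict hI hsI

theorem icoCompress_icoExtend (hI : IsOrderIdeal I) (hsI : s ∈ I) (x : BEllTwo (Set.Ico 0 s)) :
    icoCompress hI hsI (icoExtend hI hsI x) = x := by
  have h : ∀ g, icoRestrict hI hsI (adjoint (icoRestrict hI hsI) g) = g :=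
    DFunLike.congr_fun (icoRestrict_comp_adjoint hI hsI)
  ext1 g
  simp only [icoCompress, icoExtend, comp_apply, h]

theorem icoExtend_mul (hI : IsOrderIdeal I) (hsI : s ∈ I) (x y : BEllTwo (Set.Ico 0 s)) :
    icoExtend hI hsI (x * y) = icoExtend hI hsI x * icoExtend hI hsI y := by
  have h : ∀ g, icoRestrict hI hsI (adjoint (icoRestrict hI hsI) g) = g :=
    DFunLike.congr_fun (icoRestrict_comp_adjoint hI hsI)
  ext1 g
  simp only [icoExtend, comp_apply, mul_apply_eq_comp, h]

theorem icoExtend_add (hI : IsOrderIdeal I) (hsI : s ∈ I) (x y : BEllTwo (Set.Ico 0 s)) :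
    icoExtend hI hsI (x + y) = icoExtend hI hsI x + icoExtend hI hsI y := by
  simp only [icoExtend, add_comp, comp_add]

theorem icoExtend_smul (hI : IsOrderIdeal I) (hsI : s ∈ I) (c : ℂ) (x : BEllTwo (Set.Ico 0 s)) :
    icoExtend hI hsI (c • x) = c • icoExtend hI hsI x := by
  simp only [icoExtend, smul_comp, comp_smul]

theorem icoExtend_star (hI : IsOrderIdeal I) (hsI : s ∈ I) (x : BEllTwo (Set.Ico 0 s)) :
    icoExtend hI hsI (star x) = star (icoExtend hI hsI x) := by
  simp only [icoExtend, star_eq_adjoint, adjoint_comp, adjoint_adjoint, comp_assoc]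

theorem icoCompress_star (hI : IsOrderIdeal I) (hsI : s ∈ I) (x : BEllTwo (Set.Ici (0 : I))) :
    icoCompress hI hsI (star x) = star (icoCompress hI hsI x) := by
  simp only [icoCompress, star_eq_adjoint, adjoint_comp, adjoint_adjoint, comp_assoc]

theorem continuous_icoExtend (hI : IsOrderIdeal I) (hsI : s ∈ I) :
    Continuous (icoExtend hI hsI) := by
  unfold icoExtend
  fun_prop

theorem continuous_icoCompress (hI : IsOrderIdeal I) (hsI : s ∈ I) :
    Continuous (icoCompress hI hsI) := by
  unfold icoCompress
  fun_prop

theorem shiftK_mem_algebraK {t : Γ} (ht : 0 ≤ t) : shiftK s t ∈ algebraK s :=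
  subset_cstarGenerated _ ⟨t, ht, rfl⟩

variable [IsOrderedAddMonoid Γ]

/-- The generators are indexed by all of `Γ⁺`, but only those with `t < s` survive, and such `t` lie
in `I`. -/
theorem shiftK_eq_zero {t : Γ} (hst : s ≤ t) : shiftK s t = 0 := by
  ext f r
  refine dif_neg fun h => ?_
  exact absurd (sub_nonneg.1 h.1) (not_le.2 (r.2.2.trans_le hst))

theorem defectProj_apply {t : Γ} (ht : 0 ≤ t) (f : EllTwo (Set.Ici (0 : Γ)))
    (r : Set.Ici (0 : Γ)) : defectProj t f r = if t ≤ (r : Γ) then 0 else f r := by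
  change f r - shiftT t (star (shiftT t) f) r = _
  split_ifs with h
  · rw [shiftT_apply_of_le _ _ (sub_nonneg.2 h), star_shiftT_apply ht]
    simp
  · rw [shiftT_apply_of_not_le _ _ (fun h' => h (sub_nonneg.1 h')), sub_zero]

/-- Both sides are the projection onto the coordinates below `s`, as `T_s` has range supported on
`[s, ∞)`. -/
theorem adjoint_icoRestrict_comp (hI : IsOrderIdeal I) (hsI : s ∈ I) (hs : 0 ≤ s) :
    adjoint (icoRestrict hI hsI) ∘L icoRestrict hI hsI = defectProj (⟨s, hsI⟩ : I) := by
  ext f x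
  rw [defectProj_apply (Γ := I) (t := ⟨s, hsI⟩) hs]
  change adjoint (icoRestrict hI hsI) (icoRestrict hI hsI f) x = _
  split_ifs with h
  · exact adjoint_icoRestrict_apply_of_le hI hsI _ x h
  · exact adjoint_icoRestrict_apply_of_lt hI hsI _ x ⟨x.2, not_le.1 h⟩

theorem icoRestrict_comp_shiftT_comp_adjoint (hI : IsOrderIdeal I) (hsI : s ∈ I) {t : I}
    (ht : 0 ≤ t) :
    icoRestrict hI hsI ∘L shiftT t ∘L adjoint (icoRestrict hI hsI) = shiftK s (t : Γ) := by
  ext g r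
  change shiftT t (adjoint (icoRestrict hI hsI) g) (icoInclusion hI hsI r) = _
  by_cases h : 0 ≤ (r : Γ) - (t : Γ)
  · have hr : (r : Γ) - (t : Γ) ∈ Set.Ico 0 s :=
      ⟨h, (sub_le_self (r : Γ) ht).trans_lt r.2.2⟩
    rw [shiftT_apply_of_le _ (icoInclusion hI hsI r) h]
    refine (adjoint_icoRestrict_apply_of_lt hI hsI g _ hr).trans ?_
    rw [shiftK, truncShift_apply, dif_pos hr]
    rfl
  · rw [shiftT_apply_of_not_le _ (icoInclusion hI hsI r) h]
    rw [shiftK, truncShift_apply, dif_neg fun h' => h h'.1]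

theorem icoExtend_icoCompress (hI : IsOrderIdeal I) (hsI : s ∈ I) (hs : 0 ≤ s)
    (x : BEllTwo (Set.Ici (0 : I))) :
    icoExtend hI hsI (icoCompress hI hsI x) =
      defectProj (⟨s, hsI⟩ : I) * x * defectProj (⟨s, hsI⟩ : I) := by
  rw [← adjoint_icoRestrict_comp hI hsI hs]
  rfl

/-- The compression is multiplicative on products `T_a y`, since `[0, s)` is an initial segment. -/
theorem icoCompress_shiftT_mul (hI : IsOrderIdeal I) (hsI : s ∈ I) (hs : 0 ≤ s) {a : I}
    (ha : 0 ≤ a) (y : BEllTwo (Set.Ici (0 : I))) :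
    icoCompress hI hsI (shiftT a * y) = shiftK s (a : Γ) * icoCompress hI hsI y := by
  have hs' : 0 ≤ (⟨s, hsI⟩ : I) := hs
  -- With `p` the projection, `p T_a (1 - p) = p T_a T_s T_s⋆ = (p T_s) T_a T_s⋆ = 0`.
  have hp : defectProj (⟨s, hsI⟩ : I) * shiftT a =
      defectProj (⟨s, hsI⟩ : I) * shiftT a * defectProj (⟨s, hsI⟩ : I) := by
    conv_rhs => rw [mul_assoc, defectProj.eq_1, mul_sub (shiftT a), mul_one, ← mul_assoc (shiftT a),
      shiftT_comm ha hs', mul_sub, ← defectProj.eq_1, mul_assoc (shiftT (⟨s, hsI⟩ : I)),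
      ← mul_assoc (defectProj (⟨s, hsI⟩ : I)) (shiftT (⟨s, hsI⟩ : I)),
      defectProj_mul_shiftT hs' le_rfl, zero_mul, sub_zero]
  rw [← adjoint_icoRestrict_comp hI hsI hs] at hp
  have h : ∀ g, icoRestrict hI hsI (adjoint (icoRestrict hI hsI) g) = g :=
    DFunLike.congr_fun (icoRestrict_comp_adjoint hI hsI)
  rw [← icoRestrict_comp_shiftT_comp_adjoint hI hsI ha]
  ext1 g
  have := congrArg (icoRestrict hI hsI) (DFunLike.congr_fun hp (y (adjoint (icoRestrict hI hsI) g)))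
  simpa only [icoCompress, comp_apply, mul_apply_eq_comp, h] using this

/-- Compression is not multiplicative, so generators do not suffice; the spanning products `T_a
T_b⋆` do, going to `K_a K_b⋆`. -/
theorem icoCompress_mem_algebraK (hI : IsOrderIdeal I) (hsI : s ∈ I) (hs : 0 ≤ s)
    {x : BEllTwo (Set.Ici (0 : I))} (hx : x ∈ toeplitzAlgebra I) :
    icoCompress hI hsI x ∈ algebraK s := by
  refine closure_minimal (t := icoCompress hI hsI ⁻¹' (algebraK s)) (fun y hy => ?_)
    ((algebraK_isClosed s).preimage (continuous_icoCompress hI hsI))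
    (toeplitzAlgebra_le_closure_wienerHopfSpan hx)
  change icoCompress hI hsI y ∈ algebraK s
  induction hy using Submodule.span_induction with
  | mem y hy =>
    obtain ⟨a, b, ha, hb, rfl⟩ := hy
    have hb' := icoRestrict_comp_shiftT_comp_adjoint hI hsI hb
    rw [icoCompress_shiftT_mul hI hsI hs ha, icoCompress_star]
    refine mul_mem (shiftK_mem_algebraK ha) (star_mem ?_)
    rw [icoCompress, hb']
    exact shiftK_mem_algebraK hb
  | zero => simp [icoCompress]
  | add y z _ _ h1 h2 =>
    have : icoCompress hI hsI (y + z) = icoCompress hI hsI y + icoCompress hI hsI z := by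
      simp only [icoCompress, add_comp, comp_add]
    rw [this]
    exact add_mem h1 h2
  | smul c y _ h =>
    have : icoCompress hI hsI (c • y) = c • icoCompress hI hsI y := by
      simp only [icoCompress, smul_comp, comp_smul]
    rw [this]
    exact (algebraK s).smul_mem c h

theorem icoExtend_mem_toeplitzCorner (hI : IsOrderIdeal I) (hsI : s ∈ I) (hs : 0 ≤ s)
    {x : BEllTwo (Set.Ico 0 s)} (hx : x ∈ algebraK s) :
    icoExtend hI hsI x ∈ toeplitzCorner (⟨s, hsI⟩ : I) hs := by
  have hclosed : IsClosed (toeplitzCorner (⟨s, hsI⟩ : I) hs : Set (BEllTwo (Set.Ici (0 : I)))) :=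
    isClosed_cornerSubalgebra (toeplitzCommutatorIdeal_isClosed I)
      (isStarProjection_defectProj (s := (⟨s, hsI⟩ : I)) hs) _
  have hgen : ∀ t : Γ, 0 ≤ t →
      icoExtend hI hsI (shiftK s t) ∈ toeplitzCorner (⟨s, hsI⟩ : I) hs := by
    intro t ht
    rcases le_or_gt s t with hst | hst
    · rw [shiftK_eq_zero hst]
      simp [icoExtend]
    · have ht' : (0 : I) ≤ ⟨t, hI s hsI t ht hst.le⟩ := ht
      have h := icoRestrict_comp_shiftT_comp_adjoint hI hsI ht'
      change icoCompress hI hsI _ = _ at h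
      rw [← h, icoExtend_icoCompress hI hsI hs]
      have hpp : defectProj (⟨s, hsI⟩ : I) * defectProj (⟨s, hsI⟩ : I) =
          defectProj (⟨s, hsI⟩ : I) :=
        (isStarProjection_defectProj (s := (⟨s, hsI⟩ : I)) hs).isIdempotentElem
      -- The corner needs a middle factor in the commutator ideal: `T_t p` lies there because `p`
      -- does, and `p (T_t p) p = p T_t p`.
      refine ⟨shiftT ⟨t, hI s hsI t ht hst.le⟩ * defectProj (⟨s, hsI⟩ : I),
        mul_mem_commutatorIdeal_left (shiftT_mem_toeplitzAlgebra ht')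
          (defectProj_mem_toeplitzCommutatorIdeal (s := (⟨s, hsI⟩ : I)) hs), ?_⟩
      simp only [mul_assoc, hpp]
  refine cstarGenerated_induction (P := fun x => icoExtend hI hsI x ∈
    toeplitzCorner (⟨s, hsI⟩ : I) hs) ?_ ?_ ?_ ?_ ?_ ?_ ?_ x hx
  · rintro _ ⟨t, ht, rfl⟩
    exact hgen t ht
  · rintro _ ⟨t, ht, rfl⟩
    rw [icoExtend_star]
    exact star_mem (hgen t ht)
  · simp [icoExtend]
  · intro x _ y _ h1 h2
    rw [icoExtend_add]
    exact add_mem h1 h2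
  · intro x _ y _ h1 h2
    rw [icoExtend_mul]
    exact mul_mem h1 h2
  · intro c x _ h
    rw [icoExtend_smul]
    exact (toeplitzCorner (⟨s, hsI⟩ : I) hs).smul_mem c h
  · exact hclosed.preimage (continuous_icoExtend hI hsI)

/-- The algebra of truncated shifts is the corner of the commutator ideal of the Toeplitz algebra
of any order ideal that contains `s`. -/
def algebraKEquivToeplitzCorner (hI : IsOrderIdeal I) (hsI : s ∈ I) (hs : 0 ≤ s) :
    algebraK s ≃⋆ₐ[ℂ] toeplitzCorner (⟨s, hsI⟩ : I) hs where
  toFun x := ⟨icoExtend hI hsI x, icoExtend_mem_toeplitzCorner hI hsI hs x.2⟩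
  invFun y := ⟨icoCompress hI hsI y, icoCompress_mem_algebraK hI hsI hs
    (commutatorIdeal_le _ ((mem_cornerSubalgebra_iff
      (isStarProjection_defectProj (s := (⟨s, hsI⟩ : I)) hs) _).1 y.2).1)⟩
  left_inv x := Subtype.ext (icoCompress_icoExtend hI hsI x)
  right_inv y := by
    obtain ⟨-, h1, h2⟩ := (mem_cornerSubalgebra_iff
      (isStarProjection_defectProj (s := (⟨s, hsI⟩ : I)) hs) _).1 y.2
    refine Subtype.ext ((icoExtend_icoCompress hI hsI hs (y : BEllTwo (Set.Ici (0 : I)))).trans ?_)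
    rw [h1, h2]
  map_mul' x y := Subtype.ext (icoExtend_mul hI hsI x y)
  map_add' x y := Subtype.ext (icoExtend_add hI hsI x y)
  map_smul' c x := Subtype.ext (icoExtend_smul hI hsI c x)
  map_star' x := Subtype.ext (icoExtend_star hI hsI x)

end Corner

end

theorem proposition3p3 {Γ : Type*} [AddCommGroup Γ] [LinearOrder Γ] [IsOrderedAddMonoid Γ]
    (s : Γ) (hs : 0 ≤ s) :
    ∃ (I : AddSubgroup Γ) (hsI : s ∈ I),
      IsLeast {J : AddSubgroup Γ | IsOrderIdeal J ∧ s ∈ J} I ∧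
      (∀ t : Γ, 0 ≤ t → (t ∈ I ↔ ∃ n : ℕ, t ≤ n • s)) ∧
      IsStarProjection (defectProj (⟨s, hsI⟩ : I)) ∧
      defectProj (⟨s, hsI⟩ : I) ∈ toeplitzCommutatorIdeal I ∧
      Nonempty (algebraK s ≃⋆ₐ[ℂ] toeplitzCorner (⟨s, hsI⟩ : I) hs) ∧
      IsFullCorner (toeplitzCommutatorIdeal I) (defectProj (⟨s, hsI⟩ : I)) ∧
      MoritaEquivalent (algebraK s) (toeplitzCommutatorIdeal I) := by
  have hI := isOrderIdeal_orderIdealClosure s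
  have hsI := self_mem_orderIdealClosure hs
  have hs' : (0 : orderIdealClosure s) ≤ ⟨s, hsI⟩ := hs
  have hfull : IsFullCorner (toeplitzCommutatorIdeal (orderIdealClosure s))
      (defectProj ⟨s, hsI⟩) := by
    refine isFullCorner_defectProj hs' fun t ht => ?_
    obtain ⟨n, hn⟩ := (mem_orderIdealClosure_iff (t := (t : Γ)) ht).1 t.2
    exact ⟨n, hn⟩
  exact ⟨orderIdealClosure s, hsI, isLeast_orderIdealClosure hs,
    fun t ht => mem_orderIdealClosure_iff ht, isStarProjection_defectProj hs',
    defectProj_mem_toeplitzCommutatorIdeal hs', ⟨algebraKEquivToeplitzCorner hI hsI hs⟩, hfull,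
    moritaEquivalent_of_fullCorner _ (isStarProjection_defectProj hs')
      (defectProj_mem_toeplitzCommutatorIdeal hs') (defectProj_mul_mem hs')
      (algebraKEquivToeplitzCorner hI hsI hs) hfull⟩
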